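/- Consider a metro line of length $L>0$ with $n$ segments in cyclic order; indices $j$ are modulo $n$, and segment $j$ goes from node $j-1$ to node $j$. Some of the nodes are platforms. Let $r_j\ge 0$ be the running times, $\underline w_j\ge 0$ the minimum dwell times (with $\underline w_j>0$ at platforms), $\underline s_j\in\mathbb R$ the minimum safety times, and, at platforms, let $\lambda_j\ge 0$ be the passenger arrival rates and $\alpha_j>0$ the passenger upload rates. Let $b_j\in\{0,1\}$ be the number of trains on segment $j$ at time zero, $\bar b_j=1-b_j$, $m=\sum_j b_j$ the number of trains, and $\rho=m/L$ the train density. Write $d_j^k$ for the $k$-th departure time from node $j$; the initial state $d^0\in\mathbb R^n$ is arbitrary. Put, for $k\ge 1$, $$A_j^k=d_{j-1}^{k-b_j}+r_j+\underline w_j,\qquad C_j^k=d_{j+1}^{k-\bar b_{j+1}}+\underline s_{j+1}.$$ The max-plus model is $d_j^k=\max\{A_j^k,C_j^k\}$ for all $j$. The controlled model, with parameters $\bar w_j$ and $\delta_j$, is $d_j^k=\max\{A_j^k,C_j^k\}$ at non-platform nodes and $$d_j^k=\max\bigl\{A_j^k,\ (1-\delta_j)d_{j-1}^{k-b_j}+\delta_j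 d_j^{k-1}+(1-\delta_j)r_j+\bar w_j,\ C_j^k\bigr\}$$ at platforms. Each model is an implicit system $d^k=\mathbf f(d^k,d^{k-1})$; a real $\mu$ is an additive eigenvalue of it if there is $v\in\mathbb R^n$ with $\mathbf f(v,v-\mu\mathbf 1)=v$ (so that $d^k=v+k\mu\mathbf 1$ is a stationary regime). We say that the model is stable with rate $h$ if every initial state determines a unique trajectory, $h$ is its unique additive eigenvalue, and $\lim_{k\to\infty}d_j^k/k=h$ for every $j$ and every initial state $d^0$. Fix a density $\rho=m/L$ with $m$ an integer, $0<m<n$. Then there is a real $\tilde h(\rho)$ such that the max-plus model is stable with rate $\tilde h(\rho)$ for all initial train positions of density $\rho$. Let $w^*$ be an asymptotic average dwell time on platforms of the max-plus model at density $\rho$, that is, the limit as $K\to\infty$ of the mean over $k=1,\dots,K$ and over all platforms $j$ of $d_j^k-d_{j-1}^{k-b_j}-r_j$ along some trajectory (such a $w^*$ exists; if there are no platforms these means are taken to be $0$). Set $$\tilde\lambda_j(\rho)=\frac{\alpha_j w^*}{\tilde h(\rho)},\qquad \bar w_j=\tilde h(\rho),\qquad \delta_j(\rho)=\frac{\tilde\lambda_j(\rho)}{\max(\lambda_j,\tilde\lambda_j(\rho))}$$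 at the platforms. Then $\delta_j(\rho)\in[0,1]$, and there is a real $h(\rho)$ such that the controlled model with these parameters is stable with rate $h(\rho)$ for all initial train positions of density $\rho$. Moreover $h(\rho)\ge\tilde h(\rho)$. -/

import Mathlib

open Filter Topology

/-! ### Implicit dynamic systems `x^k = f (x^k, x^{k-1})` on `ℝ^ι` -/

/-- `d` is a trajectory of the (implicit) dynamic system `d^k = f (d^k, d^{k-1})`, `k ≥ 1`.
The first argument of `f` is the current state, the second one the previous state. -/
def IsTrajectory {ι : Type*} (f : (ι → ℝ) → (ι → ℝ) → ι → ℝ) (d : ℕ → ι → ℝ) : Prop :=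
  ∀ k : ℕ, d (k + 1) = f (d (k + 1)) (d k)

/-- Every initial state determines exactly one trajectory. -/
def IsWellPosed {ι : Type*} (f : (ι → ℝ) → (ι → ℝ) → ι → ℝ) : Prop :=
  ∀ d₀ : ι → ℝ, ∃! d : ℕ → ι → ℝ, d 0 = d₀ ∧ IsTrajectory f d

/-- `μ` is a (generalized) additive eigenvalue of `f`: there is a finite eigenvector `v` with
`f (v, v - μ) = v`; equivalently `d^k = v + k μ` is a (stationary) trajectory. -/
def IsAdditiveEigenvalue {ι : Type*} (f : (ι → ℝ) → (ι → ℝ) → ι → ℝ) (μ : ℝ) : Prop :=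
  ∃ v : ι → ℝ, f v (fun i => v i - μ) = v

/-- Along every trajectory, whatever its initial state, all the components have the asymptotic
average growth `h`. -/
def HasGrowthRate {ι : Type*} (f : (ι → ℝ) → (ι → ℝ) → ι → ℝ) (h : ℝ) : Prop :=
  ∀ d : ℕ → ι → ℝ, IsTrajectory f d →
    ∀ i : ι, Tendsto (fun k : ℕ => d k i / (k : ℝ)) atTop (𝓝 h)

/-- The system is well posed, has a stationary regime whose unique additive eigenvalue is `h`, and
its asymptotic average growth vector is `(h, …, h)` for every initial state. -/
structure IsStableWithRate {ι : Type*} (f : (ι → ℝ) → (ι → ℝ) → ι → ℝ) (h : ℝ) : Prop where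
  wellPosed : IsWellPosed f
  eigenvalue : IsAdditiveEigenvalue f h
  eigenvalue_unique : ∀ μ : ℝ, IsAdditiveEigenvalue f μ → μ = h
  growthRate : HasGrowthRate f h

/-! ### The metro line -/

/-- A metro line with `n` segments (and nodes) in cyclic order, indexed by `ZMod n`.
Segment `j` goes from node `j - 1` to node `j`. -/
structure MetroLine (n : ℕ) where
  /-- length of the line -/
  length : ℝ
  /-- the nodes that are platforms -/
  platforms : Finset (ZMod n)
  /-- running times -/
  run : ZMod n → ℝ
  /-- minimum dwell times -/
  minDwell : ZMod n → ℝ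
  /-- minimum safety times -/
  minSafe : ZMod n → ℝ
  /-- passenger arrival rates to the platforms -/
  arrival : ZMod n → ℝ
  /-- passenger upload rates at the platforms -/
  upload : ZMod n → ℝ
  length_pos : 0 < length
  run_nonneg : ∀ j, 0 ≤ run j
  minDwell_nonneg : ∀ j, 0 ≤ minDwell j
  minDwell_pos : ∀ j ∈ platforms, 0 < minDwell j
  arrival_nonneg : ∀ j ∈ platforms, 0 ≤ arrival j
  upload_pos : ∀ j ∈ platforms, 0 < upload j

namespace MetroLine

variable {n : ℕ} (M : MetroLine n)

/-- Train density `m / L`, where `m` is the number of trains and `b j` tells whether a train is on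
segment `j` at time zero. -/
noncomputable def density [NeZero n] (b : ZMod n → Bool) : ℝ :=
  ((∑ j, (b j).toNat : ℕ) : ℝ) / M.length

/-- `d_{j-1}^{k - b_j}`, where `x = d^k` and `y = d^{k-1}`. -/
def upstream (b : ZMod n → Bool) (x y : ZMod n → ℝ) (j : ZMod n) : ℝ :=
  if b j then y (j - 1) else x (j - 1)

/-- `d_{j+1}^{k - (1 - b_{j+1})}`, where `x = d^k` and `y = d^{k-1}`. -/
def downstream (b : ZMod n → Bool) (x y : ZMod n → ℝ) (j : ZMod n) : ℝ :=
  if b (j + 1) then x (j + 1) else y (j + 1)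

/-- The train dynamics without passengers (max-plus linear): travel time constraint and safe
separation constraint only. -/
noncomputable def maxPlusMap (b : ZMod n → Bool) (x y : ZMod n → ℝ) (j : ZMod n) : ℝ :=
  max (upstream b x y j + M.run j + M.minDwell j) (downstream b x y j + M.minSafe (j + 1))

/-- The controlled train dynamics, with control parameters `wbar` and `δ` at the platforms. -/
noncomputable def controlledMap (wbar δ : ZMod n → ℝ) (b : ZMod n → Bool)
    (x y : ZMod n → ℝ) (j : ZMod n) : ℝ :=
  if j ∈ M.platforms then
    max (upstream b x y j + M.run j + M.minDwell j)
      (max ((1 - δ j) * upstream b x y j + δ j * y j + (1 - δ j) * M.run j + wbar j)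
        (downstream b x y j + M.minSafe (j + 1)))
  else M.maxPlusMap b x y j

/-- Dwell time `w_j^{k+1} = d_j^{k+1} - a_j^{k+1}` at node `j`, the arrival time being
`a_j^{k+1} = d_{j-1}^{k+1-b_j} + r_j`. -/
def dwell (b : ZMod n → Bool) (d : ℕ → ZMod n → ℝ) (k : ℕ) (j : ZMod n) : ℝ :=
  d (k + 1) j - (upstream b (d (k + 1)) (d k) j + M.run j)

/-- `w` is the asymptotic average dwell time on platforms along `d` (average over the platforms and
over the departures `1, …, K`, `K → ∞`). -/
def IsMeanPlatformDwell (b : ZMod n → Bool) (d : ℕ → ZMod n → ℝ) (w : ℝ) : Prop :=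
  Tendsto (fun K : ℕ => (∑ k ∈ Finset.range K,
    (∑ j ∈ M.platforms, M.dwell b d k j) / (M.platforms.card : ℝ)) / (K : ℝ)) atTop (𝓝 w)

/-- `w` is the asymptotic average dwell time on platforms of the max-plus train dynamics at train
density `ρ` (for some initial positions of the trains and some initial state). -/
def IsMaxPlusPlatformDwell [NeZero n] (ρ w : ℝ) : Prop :=
  ∃ (b : ZMod n → Bool) (d : ℕ → ZMod n → ℝ),
    M.density b = ρ ∧ IsTrajectory (M.maxPlusMap b) d ∧ M.IsMeanPlatformDwell b d w

/-- The average passenger service rate `α_j w / h` of platform `j` for mean platform dwell time `w`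
and mean time-headway `h`. -/
noncomputable def serviceRate (w h : ℝ) (j : ZMod n) : ℝ :=
  M.upload j * w / h

/-- The control parameter `δ_j = λ̃_j / max (λ_j, λ̃_j)`, where `λ̃_j = α_j w / h`. -/
noncomputable def controlDelta (w h : ℝ) (j : ZMod n) : ℝ :=
  M.serviceRate w h j / max (M.arrival j) (M.serviceRate w h j)

end MetroLine

/-! Both models are monotone and commute with adding constants. With at least one train and one
empty segment the implicit dependencies are acyclic, so induction on a rank gives a comparison
principle (`comparison`). Hence trajectories exist and are unique, and any stationary regime stays
at bounded distance from every trajectory, fixing the growth rate and the eigenvalue. An eigenvector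
exists by vanishing discount (`exists_additive_eigenvector`): the travel constraint, followed around
the ring, bounds the oscillation of states with bounded displacement. A gauge shift shows that the
eigenvalue depends only on the number of trains. Since `w` and `htilde` are nonnegative, `δ` lies in
`[0,1]`, which makes the controlled rule monotone. It dominates the max-plus rule, so comparison
gives `htilde ≤ h`. -/

/-! ### Monotone, additively homogeneous, triangular implicit systems -/

section ImplicitSystem

variable {ι : Type*}

/-- `f` is nondecreasing and commutes with the addition of a constant to both states, and
`x = f (x, y)` can be solved for `x` in the order given by some rank on the components. -/
structure IsTriangularTopical (f : (ι → ℝ) → (ι → ℝ) → ι → ℝ) : Prop where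
  mono : ∀ {x x' y y' : ι → ℝ}, x ≤ x' → y ≤ y' → f x y ≤ f x' y'
  hom : ∀ (x y : ι → ℝ) (c : ℝ) (i : ι), f (fun j => x j + c) (fun j => y j + c) i = f x y i + c
  rank : ∃ r : ι → ℕ, ∀ (x x' y : ι → ℝ) (i : ι), (∀ j, r j < r i → x j = x' j) →
    f x y i = f x' y i

namespace IsTriangularTopical

variable {f : (ι → ℝ) → (ι → ℝ) → ι → ℝ}

theorem comparison (hf : IsTriangularTopical f) {x x' y y' : ι → ℝ} {c : ℝ} (hx : x ≤ f x y)
    (hx' : f x' y' ≤ x') (hy : ∀ i, y i ≤ y' i + c) (i : ι) : x i ≤ x' i + c := by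
  classical
  obtain ⟨r, hr⟩ := hf.rank
  induction hk : r i using Nat.strong_induction_on generalizing i with
  | _ k ih =>
    subst hk
    -- By triangularity, only coordinates of lower rank matter, and there the bound is known by
    -- induction; the others may be replaced by the target bound.
    let z : ι → ℝ := fun j => if r j < r i then x j else x' j + c
    have hz : z ≤ fun j => x' j + c := by
      intro j
      by_cases h : r j < r i
      · simpa [z, h] using ih _ h j rfl
      · simp [z, h]
    calc x i ≤ f x y i := hx i
      _ = f z y i := hr _ _ _ _ fun j hj => by simp [z, hj]
      _ ≤ f (fun j => x' j + c) (fun j => y' j + c) i := hf.mono hz hy i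
      _ = f x' y' i + c := hf.hom _ _ _ _
      _ ≤ x' i + c := by linarith [hx' i]

/-- Iterating `f · y` from any start freezes a coordinate once the number of steps exceeds its rank,
and ranks are bounded. -/
theorem exists_solution [Finite ι] (hf : IsTriangularTopical f) (y : ι → ℝ) :
    ∃ x, x = f x y := by
  obtain ⟨r, hr⟩ := hf.rank
  let z : ℕ → ι → ℝ := fun N => (fun x => f x y)^[N] 0
  have hz (N : ℕ) : z (N + 1) = f (z N) y := Function.iterate_succ_apply' _ _ _
  have stab (i : ι) : ∀ N, r i < N → z (N + 1) i = z N i := by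
    induction hk : r i using Nat.strong_induction_on generalizing i with
    | _ k ih =>
      subst hk
      intro N hN
      obtain ⟨N, rfl⟩ := Nat.exists_eq_succ_of_ne_zero (by omega : N ≠ 0)
      rw [Nat.succ_eq_add_one, hz (N + 1), hz N]
      refine hr _ _ _ _ fun j hj => ?_
      rw [← hz N]
      exact ih _ hj j rfl N (by omega)
  obtain ⟨B, hB⟩ := (Set.finite_range r).bddAbove
  refine ⟨z (B + 1), ?_⟩
  rw [← hz]
  funext i
  exact (stab i _ (Nat.lt_succ_of_le (hB ⟨i, rfl⟩))).symm

theorem solution_unique (hf : IsTriangularTopical f) {x x' y : ι → ℝ} (hx : x = f x y)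
    (hx' : x' = f x' y) : x = x' := by
  funext i
  have h₁ := hf.comparison (c := 0) hx.le hx'.ge (fun i => by simp) i
  have h₂ := hf.comparison (c := 0) hx'.le hx.ge (fun i => by simp) i
  linarith

theorem isWellPosed [Finite ι] (hf : IsTriangularTopical f) : IsWellPosed f := by
  intro d₀
  choose F hF using hf.exists_solution
  refine ⟨fun k => F^[k] d₀, ⟨rfl, fun k => ?_⟩, ?_⟩
  · simp only [Function.iterate_succ_apply']
    exact hF _
  · rintro d ⟨h0, hd⟩
    funext k
    induction k with
    | zero => exact h0
    | succ k ih =>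
      rw [Function.iterate_succ_apply', ← ih]
      exact hf.solution_unique (hd k) (hF _)

/-- Sub- and supertrajectories suffice, so two different systems can be compared. -/
theorem trajectory_comparison (hf : IsTriangularTopical f) {d d' : ℕ → ι → ℝ} {c : ℝ}
    (hd : ∀ k, d (k + 1) ≤ f (d (k + 1)) (d k)) (hd' : ∀ k, f (d' (k + 1)) (d' k) ≤ d' (k + 1))
    (h0 : ∀ i, d 0 i ≤ d' 0 i + c) (k : ℕ) (i : ι) : d k i ≤ d' k i + c := by
  induction k generalizing i with
  | zero => exact h0 i
  | succ k ih => exact hf.comparison (hd k) (hd' k) ih i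

theorem isTrajectory_stationary (hf : IsTriangularTopical f) {v : ι → ℝ} {μ : ℝ}
    (hv : f v (fun i => v i - μ) = v) : IsTrajectory f (fun k i => v i + k * μ) := by
  intro k
  funext i
  have h := hf.hom v (fun i => v i - μ) (((k + 1 : ℕ) : ℝ) * μ) i
  rw [hv] at h
  refine h.symm.trans ?_
  congr 1
  funext j
  push_cast
  ring

theorem tendsto_div_of_abs_sub_le {u : ℕ → ℝ} {a μ C : ℝ} (h : ∀ k : ℕ, |u k - (a + k * μ)| ≤ C) :
    Tendsto (fun k : ℕ => u k / (k : ℝ)) atTop (𝓝 μ) := by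
  have hlim : Tendsto (fun k : ℕ => (C + |a|) / (k : ℝ)) atTop (𝓝 0) :=
    tendsto_const_div_atTop_nhds_zero_nat _
  rw [tendsto_iff_norm_sub_tendsto_zero]
  refine squeeze_zero' (Eventually.of_forall fun _ => norm_nonneg _) ?_ hlim
  filter_upwards [eventually_gt_atTop 0] with k hk
  have hk' : (0 : ℝ) < k := by exact_mod_cast hk
  have e : u k / k - μ = (u k - (a + k * μ) + a) / k := by field_simp; ring
  rw [e, Real.norm_eq_abs, abs_div, abs_of_pos hk']
  gcongr
  exact (abs_add_le _ _).trans (by linarith [h k])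

theorem hasGrowthRate [Finite ι] (hf : IsTriangularTopical f) {μ : ℝ}
    (hμ : IsAdditiveEigenvalue f μ) : HasGrowthRate f μ := by
  obtain ⟨v, hv⟩ := hμ
  have hs := hf.isTrajectory_stationary hv
  intro d hd i
  obtain ⟨C, hC⟩ := (Set.finite_range fun i => |d 0 i - v i|).bddAbove
  have hC' (i : ι) := abs_le.1 (hC ⟨i, rfl⟩ : |d 0 i - v i| ≤ C)
  refine tendsto_div_of_abs_sub_le (a := v i) (C := C) fun k => abs_le.2 ⟨?_, ?_⟩
  · have := hf.trajectory_comparison (d := fun k i => v i + k * μ) (c := C) (fun k => (hs k).le) (fun k => (hd k).ge)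
      (fun i => by simpa using by linarith [(hC' i).1]) k i
    linarith
  · have := hf.trajectory_comparison (d' := fun k i => v i + k * μ) (c := C) (fun k => (hd k).le)
      (fun k => (hs k).ge)
      (fun i => by simpa using by linarith [(hC' i).2]) k i
    linarith

theorem isStableWithRate [Finite ι] [Nonempty ι] (hf : IsTriangularTopical f) {μ : ℝ}
    (hμ : IsAdditiveEigenvalue f μ) : IsStableWithRate f μ where
  wellPosed := hf.isWellPosed
  eigenvalue := hμ
  eigenvalue_unique := by
    rintro μ' ⟨v, hv⟩
    let i : ι := Classical.arbitrary ι
    have h₁ := hf.hasGrowthRate hμ _ (hf.isTrajectory_stationary hv) i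
    have h₂ := hf.hasGrowthRate ⟨v, hv⟩ _ (hf.isTrajectory_stationary hv) i
    exact tendsto_nhds_unique h₂ h₁
  growthRate := hf.hasGrowthRate hμ

end IsTriangularTopical

/-- A sup-norm nonexpansive map commuting with the addition of constants has an additive
eigenvector if points with bounded displacement have bounded oscillation: take the limit of the
discounted fixed points `x = F ((1 - ε) x)` as `ε → 0`. -/
theorem exists_additive_eigenvector [Fintype ι] [Nonempty ι] {F : (ι → ℝ) → ι → ℝ}
    (hLip : LipschitzWith 1 F) (hom : ∀ x (c : ℝ), F (fun i => x i + c) = fun i => F x i + c)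
    (hosc : ∀ c : ℝ, ∃ C : ℝ, ∀ y, (∀ i, |F y i - y i| ≤ c) → ∀ i j, |y i - y j| ≤ C) :
    ∃ (v : ι → ℝ) (μ : ℝ), F v = fun i => v i + μ := by
  let i₀ : ι := Classical.arbitrary ι
  obtain ⟨C, hC⟩ := hosc ‖F 0‖
  have approx (N : ℕ) : ∃ (z : ι → ℝ) (s : ℝ), ‖z‖ ≤ C ∧ |s| ≤ ‖F 0‖ ∧
      ∀ i, |F z i - (z i + s)| ≤ C / ((N : ℝ) + 1) := by
    -- Discount factor `q = 1 - 1 / (N + 2)`, chosen so that `(1 - q) / q = 1 / (N + 1)`.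
    let q : NNReal := ((N : NNReal) + 1) / ((N : NNReal) + 2)
    have hq : (q : ℝ) = ((N : ℝ) + 1) / ((N : ℝ) + 2) := by simp [q]
    have hN : (0 : ℝ) < (N : ℝ) + 1 := by positivity
    have hN2 : (0 : ℝ) < (N : ℝ) + 2 := by positivity
    have hq1 : q < 1 := by
      rw [← NNReal.coe_lt_coe, hq, NNReal.coe_one, div_lt_one hN2]
      linarith
    have hcon : ContractingWith q (fun x : ι → ℝ => F ((q : ℝ) • x)) := by
      refine ⟨hq1, LipschitzWith.of_dist_le_mul fun x y => ?_⟩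
      refine (hLip.dist_le_mul _ _).trans (le_of_eq ?_)
      rw [dist_smul₀]
      simp
    obtain ⟨x, hx⟩ : ∃ x : ι → ℝ, F ((q : ℝ) • x) = x :=
      ⟨_, hcon.fixedPoint_isFixedPt⟩
    let y : ι → ℝ := (q : ℝ) • x
    have hy (i : ι) : y i = (q : ℝ) * x i := rfl
    have hxn : (1 - (q : ℝ)) * ‖x‖ ≤ ‖F 0‖ := by
      have h := hLip.dist_le_mul ((q : ℝ) • x) 0
      rw [hx, dist_zero_right, norm_smul, dist_eq_norm] at h
      have h2 := norm_sub_norm_le x (F 0)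
      simp only [NNReal.coe_one, one_mul, Real.norm_eq_abs, abs_of_nonneg q.coe_nonneg] at h
      linarith
    have hq1' : 0 ≤ 1 - (q : ℝ) := by
      have : (q : ℝ) < 1 := by exact_mod_cast hq1
      linarith
    have hxi (i : ι) : |(1 - (q : ℝ)) * x i| ≤ ‖F 0‖ := by
      rw [abs_mul, abs_of_nonneg hq1']
      exact (mul_le_mul_of_nonneg_left (norm_le_pi_norm x i) hq1').trans hxn
    have hFy (i : ι) : F y i - y i = (1 - (q : ℝ)) * x i := by
      have : F y i = x i := congrFun hx i
      rw [this, hy]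
      ring
    have hyC := hC y fun i => by rw [hFy]; exact hxi i
    -- Normalising `y` to vanish at `i₀` turns bounded oscillation into bounded norm, hence
    -- compactness.
    refine ⟨fun i => y i + -y i₀, (1 - (q : ℝ)) * x i₀, ?_, hxi i₀, fun i => ?_⟩
    · have hC0 : 0 ≤ C := (abs_nonneg _).trans (hyC i₀ i₀)
      refine (pi_norm_le_iff_of_nonneg hC0).2 fun i => ?_
      simpa [sub_eq_add_neg] using hyC i i₀
    · rw [hom]
      have e : F y i + -y i₀ - (y i + -y i₀ + (1 - (q : ℝ)) * x i₀)
          = (y i - y i₀) / ((N : ℝ) + 1) := by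
        rw [hy, hy, ← sub_eq_zero]
        have := hFy i
        rw [hy] at this
        rw [show F y i = (1 - (q : ℝ)) * x i + q * x i by linarith, hq]
        field_simp
        ring
      rw [e, abs_div, abs_of_pos hN]
      gcongr
      exact hyC i i₀
  choose z s hz hs hzs using approx
  obtain ⟨⟨v, μ⟩, -, φ, hφ, hlim⟩ :=
    ((isCompact_closedBall (0 : ι → ℝ) C).prod (isCompact_closedBall (0 : ℝ) ‖F 0‖)).tendsto_subseq
      (x := fun N => (z N, s N)) fun N => by
        refine ⟨?_, ?_⟩
        · simpa using hz N
        · simpa using hs N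
  have hv : Tendsto (fun N => z (φ N)) atTop (𝓝 v) := hlim.fst_nhds
  have hμ : Tendsto (fun N => s (φ N)) atTop (𝓝 μ) := hlim.snd_nhds
  refine ⟨v, μ, funext fun i => ?_⟩
  have h₁ : Tendsto (fun N => F (z (φ N)) i - (z (φ N) i + s (φ N))) atTop
      (𝓝 (F v i - (v i + μ))) :=
    (tendsto_pi_nhds.1 ((hLip.continuous.tendsto v).comp hv) i).sub
      ((tendsto_pi_nhds.1 hv i).add hμ)
  have h₂ : Tendsto (fun N => F (z (φ N)) i - (z (φ N) i + s (φ N))) atTop (𝓝 0) := by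
    refine squeeze_zero_norm (fun N => hzs (φ N) i) ?_
    have := (tendsto_const_div_atTop_nhds_zero_nat C).comp (tendsto_add_atTop_nat 1)
    refine Tendsto.congr (fun N => ?_) (this.comp hφ.tendsto_atTop)
    simp
  linarith [tendsto_nhds_unique h₁ h₂]

theorem IsTriangularTopical.exists_eigenvalue [Finite ι] [Nonempty ι]
    {f : (ι → ℝ) → (ι → ℝ) → ι → ℝ} (hf : IsTriangularTopical f)
    (hosc : ∀ c : ℝ, ∃ C : ℝ, ∀ x y, x = f x y → (∀ i, |x i - y i| ≤ c) →
      ∀ i j, |y i - y j| ≤ C) :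
    ∃ μ, IsAdditiveEigenvalue f μ := by
  have := Fintype.ofFinite ι
  choose F hF using hf.exists_solution
  have hLip : LipschitzWith 1 F := by
    refine LipschitzWith.of_dist_le_mul fun y y' => ?_
    rw [NNReal.coe_one, one_mul, dist_pi_le_iff dist_nonneg]
    intro i
    have h (j : ι) := abs_le.1 (dist_le_pi_dist y y' j)
    have h₁ := hf.comparison (c := dist y y') (hF y).le (hF y').ge
      (fun j => by linarith [(h j).2]) i
    have h₂ := hf.comparison (c := dist y y') (hF y').le (hF y).ge
      (fun j => by linarith [(h j).1]) i
    exact abs_le.2 ⟨by linarith, by linarith⟩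
  have hom (y : ι → ℝ) (c : ℝ) : F (fun i => y i + c) = fun i => F y i + c := by
    refine hf.solution_unique (hF _) (funext fun i => ?_)
    rw [hf.hom, ← hF]
  obtain ⟨v, μ, hv⟩ := exists_additive_eigenvector hLip hom fun c => by
    obtain ⟨C, hC⟩ := hosc c
    exact ⟨C, fun y hy => hC _ y (hF y) hy⟩
  -- The eigenvector is the current state `v + μ`; the previous one is `v`.
  refine ⟨μ, fun i => v i + μ, ?_⟩
  have h := hF v
  rw [hv] at h
  simpa using h.symm

end ImplicitSystem

/-! ### Functions on the cycle `ZMod n` -/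

section Cycle

variable {n : ℕ} [NeZero n]

theorem exists_forall_sub_pred_eq {g : ZMod n → ℝ} (hg : ∑ j, g j = 0) :
    ∃ c : ZMod n → ℝ, ∀ j, c j - c (j - 1) = g j := by
  let S : ℕ → ℝ := fun k => ∑ i ∈ Finset.range k, g i
  have hper : Function.Periodic S n := by
    intro k
    have hn : ∑ i ∈ Finset.range n, g ((k + i : ℕ) : ZMod n) = 0 := by
      rw [← hg]
      refine Finset.sum_bij' (fun i _ => ((k + i : ℕ) : ZMod n)) (fun j _ => (j - (k : ZMod n)).val)
        (by simp) (fun j _ => by simpa using ZMod.val_lt _) ?_ ?_ (by simp)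
      · intro i hi
        simpa using ZMod.val_cast_of_lt (Finset.mem_range.1 hi)
      · intro j _
        simp
    simp only [S]
    rw [Finset.sum_range_add, hn, add_zero]
  -- At `j = 0` the index of the predecessor is `n`, and periodicity identifies `S n` with `S 0`.
  refine ⟨fun j => S (j.val + 1), fun j => ?_⟩
  have h : S ((j - 1).val + 1) = S j.val := by
    rw [← hper.map_mod_nat, ← hper.map_mod_nat j.val]
    congr 1
    refine (ZMod.natCast_eq_natCast_iff _ _ n).1 ?_
    simp
  simp [h, S, Finset.sum_range_succ]

theorem sub_le_of_forall_pred_sub_le {y : ZMod n → ℝ} {K : ℝ} (hK : 0 ≤ K)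
    (h : ∀ j, y (j - 1) - y j ≤ K) (i j : ZMod n) : y i - y j ≤ n * K := by
  have key (k : ℕ) : y i - y (i + k) ≤ k * K := by
    induction k with
    | zero => simp
    | succ k ih =>
      have h1 := h (i + (k + 1 : ℕ))
      rw [show i + ((k + 1 : ℕ) : ZMod n) - 1 = i + k by push_cast; ring] at h1
      push_cast at h1 ⊢
      linarith
  have h1 := key (j - i).val
  rw [ZMod.natCast_zmod_val, add_sub_cancel] at h1
  refine h1.trans (mul_le_mul_of_nonneg_right ?_ hK)
  exact_mod_cast (ZMod.val_lt _).le

/-- The rank adds the distance back from segment `j` to an occupied segment and the distance forward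
from segment `j + 1` to an empty one. Along each implicit dependency one distance drops and the
other is already zero at the target. -/
theorem exists_rank_of_not_constant {b : ZMod n → Bool} (h₁ : ∃ j, b j = true)
    (h₀ : ∃ j, b j = false) :
    ∃ r : ZMod n → ℕ, (∀ j, b j = false → r (j - 1) < r j) ∧
      ∀ j, b (j + 1) = true → r (j + 1) < r j := by
  obtain ⟨t, ht⟩ := h₁
  obtain ⟨u, hu⟩ := h₀
  have e₁ (j : ZMod n) : ∃ k : ℕ, b (j - k) = true := ⟨(j - t).val, by simpa using ht⟩
  have e₀ (j : ZMod n) : ∃ k : ℕ, b (j + 1 + k) = false := ⟨(u - (j + 1)).val, by simpa using hu⟩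
  refine ⟨fun j => Nat.find (e₁ j) + Nat.find (e₀ j), fun j hj => ?_, fun j hj => ?_⟩
  · have ha : Nat.find (e₀ (j - 1)) = 0 := by simpa [Nat.find_eq_zero] using hj
    have hb : Nat.find (e₁ (j - 1)) < Nat.find (e₁ j) := by
      have hpos : Nat.find (e₁ j) ≠ 0 := by simp [Nat.find_eq_zero, hj]
      obtain ⟨k, hk⟩ := Nat.exists_eq_succ_of_ne_zero hpos
      have hs := Nat.find_spec (e₁ j)
      rw [hk] at hs ⊢
      refine Nat.lt_succ_of_le (Nat.find_le ?_)
      convert hs using 2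
      push_cast
      ring
    simp only [ha, add_zero]
    exact hb.trans_le (Nat.le_add_right _ _)
  · have ha : Nat.find (e₁ (j + 1)) = 0 := by simpa [Nat.find_eq_zero] using hj
    have hb : Nat.find (e₀ (j + 1)) < Nat.find (e₀ j) := by
      have hpos : Nat.find (e₀ j) ≠ 0 := by simp [Nat.find_eq_zero, hj]
      obtain ⟨k, hk⟩ := Nat.exists_eq_succ_of_ne_zero hpos
      have hs := Nat.find_spec (e₀ j)
      rw [hk] at hs ⊢
      refine Nat.lt_succ_of_le (Nat.find_le ?_)
      convert hs using 2
      push_cast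
      ring
    simp only [ha, zero_add]
    exact hb.trans_le (Nat.le_add_left _ _)

end Cycle

/-! ### Train dynamics on the ring -/

namespace MetroLine

variable {n : ℕ}

/-- Train dynamics on the ring with a local rule `φ` at each node, applied to the upstream
departure, the previous departure at the node, and the downstream departure. -/
def ringMap (φ : ZMod n → ℝ → ℝ → ℝ → ℝ) (b : ZMod n → Bool) (x y : ZMod n → ℝ) (j : ZMod n) : ℝ :=
  φ j (upstream b x y j) (y j) (downstream b x y j)

/-- The local rules are nondecreasing, commute with the addition of a constant, and respect
minimum travel times `t`. -/
structure IsTopicalRule (φ : ZMod n → ℝ → ℝ → ℝ → ℝ) (t : ZMod n → ℝ) : Prop where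
  mono : ∀ j {a a' p p' c c' : ℝ}, a ≤ a' → p ≤ p' → c ≤ c' → φ j a p c ≤ φ j a' p' c'
  hom : ∀ j (a p c e : ℝ), φ j (a + e) (p + e) (c + e) = φ j a p c + e
  travel : ∀ j (a p c : ℝ), a + t j ≤ φ j a p c

theorem upstream_mono (b : ZMod n → Bool) {x x' y y' : ZMod n → ℝ} (hx : x ≤ x') (hy : y ≤ y')
    (j : ZMod n) : upstream b x y j ≤ upstream b x' y' j := by
  unfold upstream
  split
  exacts [hy _, hx _]

theorem downstream_mono (b : ZMod n → Bool) {x x' y y' : ZMod n → ℝ} (hx : x ≤ x') (hy : y ≤ y')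
    (j : ZMod n) : downstream b x y j ≤ downstream b x' y' j := by
  unfold downstream
  split
  exacts [hx _, hy _]

theorem upstream_add (b : ZMod n → Bool) (x y : ZMod n → ℝ) (c : ℝ) (j : ZMod n) :
    upstream b (fun i => x i + c) (fun i => y i + c) j = upstream b x y j + c := by
  unfold upstream
  split <;> rfl

theorem downstream_add (b : ZMod n → Bool) (x y : ZMod n → ℝ) (c : ℝ) (j : ZMod n) :
    downstream b (fun i => x i + c) (fun i => y i + c) j = downstream b x y j + c := by
  unfold downstream
  split <;> rfl

theorem upstream_sub_const (b : ZMod n → Bool) (v : ZMod n → ℝ) (μ : ℝ) (j : ZMod n) :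
    upstream b v (fun i => v i - μ) j = v (j - 1) - ((b j).toNat : ℝ) * μ := by
  unfold upstream
  cases b j <;> simp

theorem downstream_sub_const (b : ZMod n → Bool) (v : ZMod n → ℝ) (μ : ℝ) (j : ZMod n) :
    downstream b v (fun i => v i - μ) j = v (j + 1) - (1 - ((b (j + 1)).toNat : ℝ)) * μ := by
  unfold downstream
  cases b (j + 1) <;> simp

variable {φ : ZMod n → ℝ → ℝ → ℝ → ℝ} {t : ZMod n → ℝ}

theorem IsTopicalRule.isTriangularTopical [NeZero n] (hφ : IsTopicalRule φ t) {b : ZMod n → Bool}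
    (h₁ : ∃ j, b j = true) (h₀ : ∃ j, b j = false) : IsTriangularTopical (ringMap φ b) where
  mono hx hy j := hφ.mono j (upstream_mono b hx hy j) (hy j) (downstream_mono b hx hy j)
  hom x y c j := by
    unfold ringMap
    rw [upstream_add, downstream_add, hφ.hom]
  rank := by
    obtain ⟨r, hr₀, hr₁⟩ := exists_rank_of_not_constant h₁ h₀
    refine ⟨r, fun x x' y j h => ?_⟩
    have hu : upstream b x y j = upstream b x' y j := by
      unfold upstream
      split
      · rfl
      · exact h _ (hr₀ j (by simpa using ‹¬ b j = true›))
    have hd : downstream b x y j = downstream b x' y j := by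
      unfold downstream
      split
      · exact h _ (hr₁ j ‹_›)
      · rfl
    unfold ringMap
    rw [hu, hd]

theorem IsTopicalRule.exists_eigenvalue [NeZero n] (hφ : IsTopicalRule φ t) {b : ZMod n → Bool}
    (h₁ : ∃ j, b j = true) (h₀ : ∃ j, b j = false) :
    ∃ μ, IsAdditiveEigenvalue (ringMap φ b) μ := by
  refine (hφ.isTriangularTopical h₁ h₀).exists_eigenvalue fun c => ?_
  obtain ⟨T, hT⟩ := (Set.finite_range fun j => |t j|).bddAbove
  have hT' (j : ZMod n) : |t j| ≤ T := hT ⟨j, rfl⟩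
  -- Per segment: `c` for each of the two exchanges between `x` and `y`, and `T` for the travel
  -- time, whose sign is unknown here.
  refine ⟨n * (2 * c + T), fun x y hx hc => ?_⟩
  have hc' (j : ZMod n) := abs_le.1 (hc j)
  have hstep (j : ZMod n) : y (j - 1) - y j ≤ 2 * c + T := by
    have h1 : upstream b x y j + t j ≤ x j := by
      conv_rhs => rw [hx]
      exact hφ.travel _ _ _ _
    have h2 : y (j - 1) - c ≤ upstream b x y j := by
      unfold upstream
      split <;> linarith [hc' (j - 1)]
    linarith [hc' j, abs_le.1 (hT' j)]
  have hK : 0 ≤ 2 * c + T := by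
    linarith [(abs_nonneg _).trans (hc 0), (abs_nonneg _).trans (hT' 0)]
  exact fun i j => abs_sub_le_iff.2
    ⟨sub_le_of_forall_pred_sub_le hK hstep i j, sub_le_of_forall_pred_sub_le hK hstep j i⟩

/-- The eigenvalues depend on the initial train positions only through the number of trains. -/
theorem IsTopicalRule.isAdditiveEigenvalue_of_sum_eq [NeZero n] (hφ : IsTopicalRule φ t)
    {b b' : ZMod n → Bool} (hb : ∑ j, (b j).toNat = ∑ j, (b' j).toNat) {μ : ℝ}
    (hμ : IsAdditiveEigenvalue (ringMap φ b) μ) : IsAdditiveEigenvalue (ringMap φ b') μ := by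
  obtain ⟨v, hv⟩ := hμ
  have hsum : ∑ j, (((b j).toNat : ℝ) - ((b' j).toNat : ℝ)) = 0 := by
    rw [Finset.sum_sub_distrib, sub_eq_zero]
    exact_mod_cast hb
  obtain ⟨c, hc⟩ := exists_forall_sub_pred_eq hsum
  -- As `c` has increments `b - b'`, this shift converts the delays of `b` into those of `b'`.
  refine ⟨fun j => v j + c j * μ, funext fun j => ?_⟩
  have hvj := congrFun hv j
  unfold ringMap at hvj ⊢
  rw [upstream_sub_const, downstream_sub_const] at hvj ⊢
  have hj := hc j
  have hj1 := hc (j + 1)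
  rw [add_sub_cancel_right] at hj1
  conv_rhs => rw [← hvj]
  rw [← hφ.hom]
  congr 1
  · linear_combination (-μ) * hj
  · ring
  · linear_combination μ * hj1

/-- Summed around the ring, the travel constraints cancel `v` and leave the number of trains times
`μ`. -/
theorem IsTopicalRule.eigenvalue_nonneg [NeZero n] (hφ : IsTopicalRule φ t) (ht : ∀ j, 0 ≤ t j)
    {b : ZMod n → Bool} (h₁ : ∃ j, b j = true) {μ : ℝ}
    (hμ : IsAdditiveEigenvalue (ringMap φ b) μ) : 0 ≤ μ := by
  obtain ⟨v, hv⟩ := hμ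
  have h (j : ZMod n) : v (j - 1) - ((b j).toNat : ℝ) * μ ≤ v j := by
    have h1 := hφ.travel j (upstream b v (fun i => v i - μ) j) (v j - μ)
      (downstream b v (fun i => v i - μ) j)
    have h2 := congrFun hv j
    unfold ringMap at h2
    rw [h2, upstream_sub_const] at h1
    linarith [ht j]
  have hsum := Finset.sum_le_sum fun j (_ : j ∈ Finset.univ) => h j
  rw [Finset.sum_sub_distrib, ← Finset.sum_mul,
    Fintype.sum_equiv (Equiv.subRight (1 : ZMod n)) (fun j => v (j - 1)) v fun _ => rfl] at hsum
  have hpos : 0 < ∑ j, ((b j).toNat : ℝ) := by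
    obtain ⟨j, hj⟩ := h₁
    exact Finset.sum_pos' (fun _ _ => Nat.cast_nonneg _) ⟨j, Finset.mem_univ j, by simp [hj]⟩
  exact nonneg_of_mul_nonneg_right (by linarith) hpos

theorem exists_isStableWithRate [NeZero n] (hφ : IsTopicalRule φ t) {m : ℕ} (hm : 0 < m)
    (hmn : m < n) :
    ∃ h, ∀ b : ZMod n → Bool, ∑ j, (b j).toNat = m → IsStableWithRate (ringMap φ b) h := by
  have hne {b : ZMod n → Bool} (hb : ∑ j, (b j).toNat = m) :
      (∃ j, b j = true) ∧ ∃ j, b j = false := by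
    constructor
    · by_contra! hcon
      simp [hcon] at hb
      omega
    · by_contra! hcon
      simp [hcon] at hb
      omega
  by_cases hex : ∃ b : ZMod n → Bool, ∑ j, (b j).toNat = m
  · obtain ⟨b₀, hb₀⟩ := hex
    obtain ⟨h, hh⟩ := hφ.exists_eigenvalue (hne hb₀).1 (hne hb₀).2
    exact ⟨h, fun b hb => (hφ.isTriangularTopical (hne hb).1 (hne hb).2).isStableWithRate
      (hφ.isAdditiveEigenvalue_of_sum_eq (hb₀.trans hb.symm) hh)⟩
  · exact ⟨0, fun b hb => (hex ⟨b, hb⟩).elim⟩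

theorem exists_trainPositions [NeZero n] {m : ℕ} (hmn : m ≤ n) :
    ∃ b : ZMod n → Bool, ∑ j, (b j).toNat = m := by
  obtain ⟨s, -, hs⟩ := Finset.exists_subset_card_eq (s := (Finset.univ : Finset (ZMod n)))
    (by simpa using hmn : m ≤ _)
  refine ⟨fun j => decide (j ∈ s), ?_⟩
  rw [← hs, Finset.card_eq_sum_ones, ← Finset.sum_subset s.subset_univ]
  · exact Finset.sum_congr rfl fun j hj => by simp [hj]
  · intro j _ hj
    simp [hj]

/-! ### The max-plus and controlled models as local rules -/

variable (M : MetroLine n)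

theorem density_eq_iff [NeZero n] {b : ZMod n → Bool} {m : ℕ} :
    M.density b = (m : ℝ) / M.length ↔ ∑ j, (b j).toNat = m := by
  unfold density
  rw [div_left_inj' M.length_pos.ne']
  exact Nat.cast_inj

/-- Local rule of the max-plus train dynamics. -/
noncomputable def maxPlusRule (j : ZMod n) (a _p c : ℝ) : ℝ :=
  max (a + M.run j + M.minDwell j) (c + M.minSafe (j + 1))

/-- Local rule of the controlled train dynamics. -/
noncomputable def controlledRule (wbar δ : ZMod n → ℝ) (j : ZMod n) (a p c : ℝ) : ℝ :=
  if j ∈ M.platforms then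
    max (a + M.run j + M.minDwell j)
      (max ((1 - δ j) * a + δ j * p + (1 - δ j) * M.run j + wbar j) (c + M.minSafe (j + 1)))
  else M.maxPlusRule j a p c

theorem isTopicalRule_maxPlusRule :
    IsTopicalRule M.maxPlusRule fun j => M.run j + M.minDwell j where
  mono j a a' p p' c c' ha _ hc := max_le_max (by linarith) (by linarith)
  hom j a p c e := by
    simp only [maxPlusRule]
    rw [← max_add_add_right]
    congr 1 <;> ring
  travel j a p c := (add_assoc _ _ _).ge.trans (le_max_left _ _)

theorem isTopicalRule_controlledRule {wbar δ : ZMod n → ℝ}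
    (hδ : ∀ j ∈ M.platforms, 0 ≤ δ j ∧ δ j ≤ 1) :
    IsTopicalRule (M.controlledRule wbar δ) fun j => M.run j + M.minDwell j where
  mono j a a' p p' c c' ha hp hc := by
    unfold controlledRule
    split
    · obtain ⟨h0, h1⟩ := hδ j ‹_›
      refine max_le_max (by linarith) (max_le_max ?_ (by linarith))
      have := mul_le_mul_of_nonneg_left ha (sub_nonneg.2 h1)
      have := mul_le_mul_of_nonneg_left hp h0
      linarith
    · exact M.isTopicalRule_maxPlusRule.mono j ha hp hc
  hom j a p c e := by
    unfold controlledRule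
    split
    · rw [← max_add_add_right, ← max_add_add_right]
      congr 1
      · ring
      · congr 1 <;> ring
    · exact M.isTopicalRule_maxPlusRule.hom j a p c e
  travel j a p c := by
    unfold controlledRule
    split
    · exact (add_assoc _ _ _).ge.trans (le_max_left _ _)
    · exact M.isTopicalRule_maxPlusRule.travel j a p c

theorem maxPlusMap_le_controlledMap (wbar δ : ZMod n → ℝ) (b : ZMod n → Bool) (x y : ZMod n → ℝ) :
    M.maxPlusMap b x y ≤ M.controlledMap wbar δ b x y := by
  intro j
  unfold controlledMap
  split
  · exact max_le_max le_rfl (le_max_right _ _)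
  · exact le_rfl

theorem exists_isMeanPlatformDwell {b : ZMod n → Bool} {v : ZMod n → ℝ} {μ : ℝ} :
    ∃ w, M.IsMeanPlatformDwell b (fun k i => v i + k * μ) w := by
  have hconst (k : ℕ) (j : ZMod n) : M.dwell b (fun k i => v i + k * μ) k j =
      M.dwell b (fun k i => v i + k * μ) 0 j := by
    unfold dwell upstream
    split <;> push_cast <;> ring
  refine ⟨(∑ j ∈ M.platforms, M.dwell b (fun k i => v i + k * μ) 0 j) / M.platforms.card,
    tendsto_const_nhds.congr' ?_⟩
  filter_upwards [eventually_gt_atTop 0] with K hK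
  have hK' : (K : ℝ) ≠ 0 := by exact_mod_cast hK.ne'
  simp only [hconst, Finset.sum_const, Finset.card_range, nsmul_eq_mul]
  rw [mul_div_cancel_left₀ _ hK']

variable {M}

theorem IsMaxPlusPlatformDwell.nonneg [NeZero n] {ρ w : ℝ} (h : M.IsMaxPlusPlatformDwell ρ w) :
    0 ≤ w := by
  obtain ⟨b, d, -, hd, hw⟩ := h
  refine ge_of_tendsto' hw fun K => ?_
  refine div_nonneg (Finset.sum_nonneg fun k _ => div_nonneg (Finset.sum_nonneg fun j _ => ?_)
    (Nat.cast_nonneg _)) (Nat.cast_nonneg _)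
  have h1 : upstream b (d (k + 1)) (d k) j + M.run j + M.minDwell j ≤ d (k + 1) j := by
    conv_rhs => rw [hd k]
    exact le_max_left _ _
  unfold dwell
  linarith [M.minDwell_nonneg j]

variable (M)

/-- Nonnegativity suffices: a vanishing denominator gives the value `0`. -/
theorem controlDelta_mem {w h : ℝ} (hw : 0 ≤ w) (hh : 0 ≤ h) {j : ZMod n} (hj : j ∈ M.platforms) :
    0 ≤ M.controlDelta w h j ∧ M.controlDelta w h j ≤ 1 := by
  have hs : 0 ≤ M.serviceRate w h j :=
    div_nonneg (mul_nonneg (M.upload_pos j hj).le hw) hh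
  have hm : 0 ≤ max (M.arrival j) (M.serviceRate w h j) := hs.trans (le_max_right _ _)
  exact ⟨div_nonneg hs hm, div_le_one_of_le₀ (le_max_right _ _) hm⟩

end MetroLine

theorem theorem8 (n : ℕ) [NeZero n] (M : MetroLine n) (ρ : ℝ)
    (hρ : ∃ m : ℕ, 0 < m ∧ m < n ∧ ρ = (m : ℝ) / M.length) :
    -- `htilde` is the growth rate at density `ρ` of the max-plus train dynamics
    ∃ htilde : ℝ,
      (∀ b : ZMod n → Bool, M.density b = ρ → IsStableWithRate (M.maxPlusMap b) htilde) ∧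
      (∃ wstar : ℝ, M.IsMaxPlusPlatformDwell ρ wstar) ∧
      ∀ wstar : ℝ, M.IsMaxPlusPlatformDwell ρ wstar →
        (∀ j ∈ M.platforms,
          0 ≤ M.controlDelta wstar htilde j ∧ M.controlDelta wstar htilde j ≤ 1) ∧
        ∃ h : ℝ,
          (∀ b : ZMod n → Bool, M.density b = ρ →
            IsStableWithRate
              (M.controlledMap (fun _ => htilde) (M.controlDelta wstar htilde) b) h) ∧
          htilde ≤ h := by
  obtain ⟨m, hm, hmn, rfl⟩ := hρ
  simp only [M.density_eq_iff]
  obtain ⟨b, hb⟩ := MetroLine.exists_trainPositions hmn.le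
  have hb₁ : ∃ j, b j = true := by
    by_contra! hcon
    simp [hcon] at hb
    omega
  have hb₀ : ∃ j, b j = false := by
    by_contra! hcon
    simp [hcon] at hb
    omega
  have hMP := M.isTopicalRule_maxPlusRule
  have hTop := hMP.isTriangularTopical hb₁ hb₀
  obtain ⟨htilde, hstab⟩ := MetroLine.exists_isStableWithRate hMP hm hmn
  have hpos : 0 ≤ htilde := hMP.eigenvalue_nonneg
    (fun j => add_nonneg (M.run_nonneg j) (M.minDwell_nonneg j)) hb₁ (hstab b hb).eigenvalue
  refine ⟨htilde, hstab, ?_, fun w hw => ?_⟩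
  · obtain ⟨v, hv⟩ := (hstab b hb).eigenvalue
    obtain ⟨w, hw⟩ := M.exists_isMeanPlatformDwell (b := b) (v := v) (μ := htilde)
    exact ⟨w, b, _, M.density_eq_iff.2 hb, hTop.isTrajectory_stationary hv, hw⟩
  · have hδ (j : ZMod n) (hj : j ∈ M.platforms) := M.controlDelta_mem hw.nonneg hpos hj
    obtain ⟨h, hh⟩ := MetroLine.exists_isStableWithRate
      (M.isTopicalRule_controlledRule (wbar := fun _ => htilde) hδ) hm hmn
    refine ⟨hδ, h, hh, ?_⟩
    -- Both models start from state `0`; the controlled trajectory is a supertrajectory of the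
    -- max-plus system.
    obtain ⟨d, ⟨hd0, hd⟩, -⟩ := (hstab b hb).wellPosed 0
    obtain ⟨d', ⟨hd0', hd'⟩, -⟩ := (hh b hb).wellPosed 0
    refine le_of_tendsto_of_tendsto' ((hstab b hb).growthRate d hd 0)
      ((hh b hb).growthRate d' hd' 0) fun k => ?_
    refine div_le_div_of_nonneg_right ?_ (Nat.cast_nonneg k)
    simpa using hTop.trajectory_comparison (c := 0) (fun k => (hd k).le)
      (fun k => (M.maxPlusMap_le_controlledMap _ _ b _ _).trans (hd' k).ge)
      (fun i => by simp [hd0, hd0']) k 0
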